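/- Let $k\ge 2$ be an integer. A sequence $\mathbf u=(u(n))_{n\ge 1}$ is called $k$-automatic if there is a finite set of sequences indexed by $n\ge 1$ that contains $\mathbf u$ and is closed under the operations $(v(n))_{n\ge 1}\mapsto (v(kn+r))_{n\ge 1}$ for $r=0,\dots,k-1$; for sequences indexed by $n\ge 0$ the definition is the same with $n\ge 0$ in place of $n\ge 1$. Let $K$ be a field and let $(u(n))_{n\ge 1}$ be a completely multiplicative sequence with values in $K$, i.e. $u(1)=1_K$ and $u(mn)=u(m)u(n)$ for all $m,n\ge 1$. Suppose that only finitely many primes $p$ satisfy $u(p)\ne 1_K$, and that there are at least two distinct primes $p_1,p_2$ with $u(p_i)\neq 0_K$ and $u(p_i)\ne 1_K$ for $i=1,2$. Then for every integer $k\ge 2$ the sequence $(u(n))_{n\ge 1}$ is not $k$-automatic, and neither is any sequence $(u(n))_{n\ge 0}$ obtained from it by choosing a value $u(0)\in K$. In particular, writing $v_p(n)$ for the exponent of the prime $p$ in $n$, the real sequence $\big((-1)^{v_2(n)+v_3(n)}\big)_{n\ge 1}$ is not $k$-automatic for any $k\ge 2$, whatever value one assigns at $n=0$ if the sequence is indexed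 by $n\ge 0$. -/

import Mathlib

/-- The operation `(v(n))_{n ≥ 1} ↦ (v(kn + r))_{n ≥ 1}` on sequences indexed by the positive
integers. -/
def decimate {α : Type*} (k : ℕ+) (r : ℕ) (v : ℕ+ → α) : ℕ+ → α :=
  fun n => v ⟨(k : ℕ) * (n : ℕ) + r, Nat.add_pos_left (Nat.mul_pos k.pos n.pos) r⟩

/-- A sequence `(u(n))_{n ≥ 1}` is `k`-automatic if it belongs to a finite set of sequences that is
closed under `(v(n))_{n ≥ 1} ↦ (v(kn + r))_{n ≥ 1}` for `r = 0, …, k - 1`. -/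
def IsAutomatic {α : Type*} (k : ℕ+) (u : ℕ+ → α) : Prop :=
  ∃ S : Set (ℕ+ → α), S.Finite ∧ u ∈ S ∧ ∀ v ∈ S, ∀ r < (k : ℕ), decimate k r v ∈ S

/-- The same notion for sequences `(u(n))_{n ≥ 0}`. -/
def IsAutomaticFromZero {α : Type*} (k : ℕ) (u : ℕ → α) : Prop :=
  ∃ S : Set (ℕ → α), S.Finite ∧ u ∈ S ∧ ∀ v ∈ S, ∀ r < k, (fun n => v (k * n + r)) ∈ S

/-- The sequence `(-1)^{v_2(n) + v_3(n)}`, `n ≥ 1`. -/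
def signTwoThree (n : ℕ+) : ℝ :=
  (-1) ^ (padicValNat 2 n + padicValNat 3 n)

/-! Call a prime `p` bad if `u p ≠ 1`. Let `q` be bad with `u q ≠ 0` and `k` not a power of `q`, and
let `M` be the product of the other bad primes. By pigeonhole, automaticity gives `n < n'` with `u
(k^a * M * n + r) = u (k^a * M * n' + r)` whenever `r < k^a`. Let `e` be the exponent of `q` in the
difference `k^a * M * (n' - n)` of the arguments. As `k` is not a power of `q`, `k^a` outgrows
`q^(e+2) * M`, so some `r` makes the first argument `q^(e+1)` times a number prime to all bad
primes. The second is then `q^e` times such a number, whence `u q = 1`, a contradiction. Since `k ≥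
2` cannot be a power of two distinct primes, one of the two given primes serves as `q`. -/

/-- A set of sequences closed under decimation contains all iterated decimations of its members. -/
theorem exists_mem_iterated_decimation {α : Type*} {k : ℕ+} {S : Set (ℕ+ → α)}
    (hS : ∀ v ∈ S, ∀ r < (k : ℕ), decimate k r v ∈ S) (a : ℕ) :
    ∀ v ∈ S, ∀ r < (k : ℕ) ^ a,
      ∃ w ∈ S, ∀ n m : ℕ+, (m : ℕ) = (k : ℕ) ^ a * n + r → v m = w n := by
  induction a with
  | zero =>
    intro v hv r hr
    refine ⟨v, hv, fun n m h => ?_⟩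
    congr 1
    apply PNat.eq
    simp at hr
    simp [h, hr]
  | succ a ih =>
    intro v hv r hr
    have hk : 0 < (k : ℕ) := k.pos
    obtain ⟨w, hw, hwv⟩ := ih (decimate k (r % k) v) (hS v hv _ (Nat.mod_lt _ hk)) (r / k)
      (Nat.div_lt_of_lt_mul (by rwa [pow_succ'] at hr))
    refine ⟨w, hw, fun n m h => ?_⟩
    have hpos : 0 < (k : ℕ) ^ a * n + r / k :=
      Nat.add_pos_left (Nat.mul_pos (pow_pos hk a) n.pos) _
    rw [← hwv n ⟨_, hpos⟩ rfl]
    refine congrArg v (PNat.eq ?_)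
    rw [h]
    simp only [PNat.mk_coe]
    rw [mul_add, add_assoc, Nat.div_add_mod, pow_succ']
    ring

/-- The members of a finite decimation-closed set of sequences take finitely many values. -/
theorem finite_values_of_decimate_closed {α : Type*} {k : ℕ+} (hk : 2 ≤ k) {S : Set (ℕ+ → α)}
    (hfin : S.Finite) (hS : ∀ v ∈ S, ∀ r < (k : ℕ), decimate k r v ∈ S) :
    ∃ V : Set α, V.Finite ∧ ∀ v ∈ S, ∀ n, v n ∈ V := by
  -- Stripping the last base-`k` digit of `n` replaces `v` by a decimation; this ends at the leading
  -- digit, which is below `k`.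
  refine ⟨⋃ v ∈ S, v '' Set.Iio k, hfin.biUnion fun v _ => (Set.finite_Iio k).image v, ?_⟩
  intro v hv n
  induction n using PNat.strongInductionOn generalizing v with
  | _ n ih =>
    by_cases hn : n < k
    · exact Set.mem_biUnion hv ⟨n, hn, rfl⟩
    · have hkn : (k : ℕ) ≤ n := not_lt.mp hn
      have hpos : 0 < (n : ℕ) / k := Nat.div_pos hkn k.pos
      have hlt : (n : ℕ) / k < n := Nat.div_lt_self n.pos hk
      have h := ih ⟨_, hpos⟩ hlt (decimate k (n % k) v) (hS v hv _ (Nat.mod_lt _ k.pos))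
      have he : decimate k ((n : ℕ) % k) v ⟨_, hpos⟩ = v n :=
        congrArg v (PNat.eq (Nat.div_add_mod _ _))
      rwa [he] at h

/-- For an automatic sequence, two distinct multiples of any `M` behave alike as leading blocks
of base-`k` digits. -/
theorem IsAutomatic.exists_equivalent_prefixes {α : Type*} {k : ℕ+} (hk : 2 ≤ k) {u : ℕ+ → α}
    (hu : IsAutomatic k u) (M : ℕ+) :
    ∃ n n' : ℕ+, n < n' ∧ ∀ (a r : ℕ), r < (k : ℕ) ^ a → ∀ m m' : ℕ+,
      (m : ℕ) = (k : ℕ) ^ a * (M * n) + r → (m' : ℕ) = (k : ℕ) ^ a * (M * n') + r →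
      u m = u m' := by
  obtain ⟨S, hfin, huS, hS⟩ := hu
  obtain ⟨V, hV, hSV⟩ := finite_values_of_decimate_closed hk hfin hS
  have := hfin.to_subtype
  have := hV.to_subtype
  -- Pigeonhole: `n ↦ (v (M * n))` for `v ∈ S` takes values in the finite set of maps `S → V`.
  obtain ⟨n, n', hne, heq⟩ := Finite.exists_ne_map_eq_of_infinite
    (fun (n : ℕ+) (v : S) => (⟨v.1 (M * n), hSV v.1 v.2 _⟩ : V))
  have key : ∀ w ∈ S, w (M * n) = w (M * n') := fun w hw =>
    congrArg Subtype.val (congrFun heq ⟨w, hw⟩)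
  rcases lt_or_gt_of_ne hne with h | h
  · refine ⟨n, n', h, fun a r hr m m' hm hm' => ?_⟩
    obtain ⟨w, hw, hwu⟩ := exists_mem_iterated_decimation hS a u huS r hr
    rw [hwu (M * n) m (by simpa using hm), hwu (M * n') m' (by simpa using hm'), key w hw]
  · refine ⟨n', n, h, fun a r hr m m' hm hm' => ?_⟩
    obtain ⟨w, hw, hwu⟩ := exists_mem_iterated_decimation hS a u huS r hr
    rw [hwu (M * n') m (by simpa using hm), hwu (M * n) m' (by simpa using hm'), key w hw]

theorem MonoidHom.pnat_eq_one_of_forall_prime {K : Type*} [Monoid K] (u : ℕ+ →* K) (y : ℕ+)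
    (h : ∀ p : ℕ+, p.Prime → u p ≠ 1 → ¬ (p : ℕ) ∣ y) : u y = 1 := by
  induction y using PNat.strongInductionOn with
  | _ y ih =>
    by_cases hy : y = 1
    · rw [hy, map_one]
    · obtain ⟨p, hp, z, rfl⟩ := PNat.exists_prime_and_dvd hy
      have hup : u p = 1 := by
        by_contra hne
        exact h p hp hne ⟨z, by simp⟩
      have hz : z < p * z := by
        rw [← PNat.coe_lt_coe, PNat.mul_coe]
        exact lt_mul_left z.pos (Nat.Prime.one_lt hp)
      rw [map_mul, hup, one_mul]
      refine ih z hz fun p' hp' hne hdvd => h p' hp' hne ?_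
      rw [PNat.mul_coe]
      exact Dvd.dvd.mul_left hdvd _

theorem MonoidHom.pnat_eq_pow_of_forall_prime {K : Type*} [Monoid K] (u : ℕ+ →* K) (x q : ℕ+)
    (j y : ℕ) (hx : (x : ℕ) = (q : ℕ) ^ j * y)
    (h : ∀ p : ℕ+, p.Prime → u p ≠ 1 → ¬ (p : ℕ) ∣ y) : u x = u q ^ j := by
  have hy : 0 < y := Nat.pos_of_ne_zero fun h0 => x.ne_zero (by rw [hx, h0, mul_zero])
  lift y to ℕ+ using hy
  have hxy : x = q ^ j * y := PNat.eq (by rw [hx, PNat.mul_coe, PNat.pow_coe])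
  rw [hxy, map_mul, map_pow, u.pnat_eq_one_of_forall_prime y h, mul_one]

theorem Nat.exists_mul_add_mem_Ico {N L c B : ℕ} (hN : 0 < N) (hNL : N ≤ L) (hcB : c ≤ B) :
    ∃ t, B ≤ N * t + c ∧ N * t + c < B + L := by
  -- This is `(B - c) / N` rounded up.
  refine ⟨(B - c + (N - 1)) / N, ?_, ?_⟩
  · have h1 := Nat.div_add_mod (B - c + (N - 1)) N
    have h2 := Nat.mod_lt (B - c + (N - 1)) hN
    omega
  · have h1 := Nat.div_add_mod (B - c + (N - 1)) N
    omega

/-- A completely multiplicative sequence equal to `1` at almost all primes is not `k`-automatic if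
it is neither `0` nor `1` at some prime of which `k` is not a power. -/
theorem not_isAutomatic_of_prime {K : Type*} [Field K] (u : ℕ+ →* K)
    (hfin : {p : ℕ+ | p.Prime ∧ u p ≠ 1}.Finite) {q : ℕ+} (hq : q.Prime)
    (h1 : u q ≠ 1) (h0 : u q ≠ 0) {k : ℕ+} (hk : 2 ≤ k) (hkq : ∀ s : ℕ, k ≠ q ^ s) :
    ¬ IsAutomatic k (fun n => u n) := by
  classical
  intro hu
  have hq' : Nat.Prime q := hq
  let M : ℕ+ := ∏ p ∈ hfin.toFinset.erase q, p
  have hpM : ∀ p : ℕ+, p.Prime → u p ≠ 1 → p ≠ q → (p : ℕ) ∣ M := fun p hp hup hne =>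
    PNat.dvd_iff.mp (Finset.dvd_prod_of_mem (fun p => p) (by simp [hne, hp, hup]))
  have hqM : ¬ (q : ℕ) ∣ M := by
    intro hdvd
    have hM : (M : ℕ) = ∏ p ∈ hfin.toFinset.erase q, (p : ℕ) :=
      map_prod PNat.coeMonoidHom _ _
    rw [hM, hq'.prime.dvd_finsetProd_iff] at hdvd
    obtain ⟨p, hp, hqp⟩ := hdvd
    rw [Finset.mem_erase, Set.Finite.mem_toFinset] at hp
    exact hp.1 (PNat.eq ((Nat.prime_dvd_prime_iff_eq hq' hp.2.1).mp hqp).symm)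
  obtain ⟨n, n', hlt, heq⟩ := hu.exists_equivalent_prefixes hk M
  have hlt' : (n : ℕ) < n' := hlt
  obtain ⟨s, l, hql, hkl⟩ := Nat.exists_eq_pow_mul_and_not_dvd k.ne_zero q hq'.ne_one
  obtain ⟨c, δ, hqδ, hδ⟩ := Nat.exists_eq_pow_mul_and_not_dvd
    (Nat.sub_ne_zero_of_lt hlt') q hq'.ne_one
  have hl : 1 < l := by
    rcases Nat.lt_or_ge 1 l with h | h
    · exact h
    · interval_cases l
      · exact absurd (dvd_zero _) hql
      · exact absurd (PNat.eq (by simpa using hkl)) (hkq s)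
  -- This makes `k ^ a = q ^ (s * a) * l ^ a` exceed `q ^ (e + 2) * M`, the step of the progression
  -- from which the first argument is taken.
  obtain ⟨a, ha⟩ := pow_unbounded_of_one_lt ((q : ℕ) ^ (c + 2) * M) hl
  set e := s * a + c with he
  have hka : (k : ℕ) ^ a = (q : ℕ) ^ (s * a) * l ^ a := by rw [hkl, mul_pow, pow_mul]
  have hqpos : 0 < (q : ℕ) := q.pos
  have hN : 0 < (q : ℕ) ^ (e + 2) * M := by positivity
  have hNL : (q : ℕ) ^ (e + 2) * M ≤ (k : ℕ) ^ a := by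
    rw [hka, he, add_assoc, pow_add, mul_assoc]
    exact Nat.mul_le_mul_left _ ha.le
  have hcB : (q : ℕ) ^ (e + 1) ≤ (k : ℕ) ^ a * (M * n) :=
    calc (q : ℕ) ^ (e + 1) ≤ (q : ℕ) ^ (e + 2) := Nat.pow_le_pow_right hqpos (by omega)
      _ ≤ (q : ℕ) ^ (e + 2) * M := Nat.le_mul_of_pos_right _ M.pos
      _ ≤ (k : ℕ) ^ a := hNL
      _ ≤ _ := Nat.le_mul_of_pos_right _ (Nat.mul_pos M.pos n.pos)
  obtain ⟨t, ht1, ht2⟩ := Nat.exists_mul_add_mem_Ico hN hNL hcB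
  obtain ⟨r, hr⟩ := Nat.exists_eq_add_of_le ht1
  have hrk : r < (k : ℕ) ^ a := by omega
  have hxpos : 0 < (k : ℕ) ^ a * (M * n) + r := by positivity
  have hxpos' : 0 < (k : ℕ) ^ a * (M * n') + r := by positivity
  have hx : (k : ℕ) ^ a * (M * n) + r = (q : ℕ) ^ (e + 1) * (q * M * t + 1) := by
    rw [← hr]; ring
  have hx' : (k : ℕ) ^ a * (M * n') + r =
      (q : ℕ) ^ e * (q * (q * M * t + 1) + l ^ a * δ * M) := by
    have hn' : (n' : ℕ) = n + q ^ c * δ := by omega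
    calc (k : ℕ) ^ a * (M * n') + r
        = ((k : ℕ) ^ a * (M * n) + r) + (k : ℕ) ^ a * (q ^ c * δ) * M := by rw [hn']; ring
      _ = _ := by rw [hx, hka, he]; ring
  -- The cofactor is 1 modulo every bad prime.
  have hux := u.pnat_eq_pow_of_forall_prime ⟨_, hxpos⟩ q (e + 1) _ hx (by
    intro p hp hup hdvd
    have hdiv : (p : ℕ) ∣ q * M * t := by
      by_cases hpq : p = q
      · rw [hpq, mul_assoc]; exact dvd_mul_right _ _
      · exact ((hpM p hp hup hpq).mul_left _).mul_right _
    exact Nat.Prime.one_lt hp |>.ne' (Nat.dvd_one.mp ((Nat.dvd_add_right hdiv).mp hdvd)))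
  -- Modulo `q` the cofactor is `l ^ a * δ * M`, a product of factors prime to `q`; modulo any other
  -- bad prime it is `q`.
  have hux' := u.pnat_eq_pow_of_forall_prime ⟨_, hxpos'⟩ q e _ hx' (by
    intro p hp hup hdvd
    by_cases hpq : p = q
    · rw [hpq, Nat.dvd_add_right (dvd_mul_right _ _), hq'.dvd_mul, hq'.dvd_mul] at hdvd
      rcases hdvd with (h | h) | h
      · exact hql (hq'.dvd_of_dvd_pow h)
      · exact hqδ h
      · exact hqM h
    · have hM := hpM p hp hup hpq
      rw [Nat.dvd_add_left (hM.mul_left _), Nat.Prime.dvd_mul hp] at hdvd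
      rcases hdvd with h | h
      · exact hpq (PNat.eq ((Nat.prime_dvd_prime_iff_eq hp hq').mp h))
      · exact Nat.Prime.one_lt hp |>.ne'
          (Nat.dvd_one.mp ((Nat.dvd_add_right ((hM.mul_left _).mul_right _)).mp h)))
  have hfinal := heq a r hrk ⟨_, hxpos⟩ ⟨_, hxpos'⟩ rfl rfl
  simp only [hux, hux', pow_succ] at hfinal
  exact h1 (mul_left_cancel₀ (pow_ne_zero e h0) (hfinal.trans (mul_one _).symm))

theorem not_isAutomatic_of_two_primes {K : Type*} [Field K] (u : ℕ+ →* K)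
    (hfin : {p : ℕ+ | p.Prime ∧ u p ≠ 1}.Finite)
    (h : ∃ p₁ p₂ : ℕ+, p₁.Prime ∧ p₂.Prime ∧ p₁ ≠ p₂ ∧
        u p₁ ≠ 1 ∧ u p₁ ≠ 0 ∧ u p₂ ≠ 1 ∧ u p₂ ≠ 0) {k : ℕ+} (hk : 2 ≤ k) :
    ¬ IsAutomatic k (fun n => u n) := by
  obtain ⟨p₁, p₂, hp₁, hp₂, hne, h₁, h₁', h₂, h₂'⟩ := h
  by_cases hk₁ : ∀ s : ℕ, k ≠ p₁ ^ s
  · exact not_isAutomatic_of_prime u hfin hp₁ h₁ h₁' hk hk₁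
  · refine not_isAutomatic_of_prime u hfin hp₂ h₂ h₂' hk fun t ht => ?_
    push Not at hk₁
    obtain ⟨s, hs⟩ := hk₁
    have ht0 : t ≠ 0 := by
      rintro rfl
      rw [ht, pow_zero] at hk
      exact absurd hk (by decide)
    have hdvd : (p₂ : ℕ) ∣ (p₁ : ℕ) ^ s := by
      rw [← PNat.pow_coe, ← hs, ht, PNat.pow_coe]
      exact dvd_pow_self _ ht0
    exact hne (PNat.eq
      ((Nat.prime_dvd_prime_iff_eq hp₂ hp₁).mp (Nat.Prime.dvd_of_dvd_pow hp₂ hdvd)).symm)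

/-- Dropping the term at `0` preserves automaticity. -/
theorem IsAutomaticFromZero.restrict {α : Type*} {k : ℕ+} {v : ℕ → α}
    (hv : IsAutomaticFromZero k v) : IsAutomatic k (fun n : ℕ+ => v n) := by
  obtain ⟨S, hfin, hvS, hS⟩ := hv
  refine ⟨(fun (w : ℕ → α) (n : ℕ+) => w n) '' S, hfin.image _, ⟨v, hvS, rfl⟩, ?_⟩
  rintro _ ⟨w, hw, rfl⟩ r hr
  exact ⟨_, hS w hw r hr, rfl⟩

/-- The sequence `signTwoThree` as a completely multiplicative function. -/
noncomputable def signTwoThreeHom : ℕ+ →* ℝ where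
  toFun := signTwoThree
  map_one' := by simp [signTwoThree]
  map_mul' m n := by
    have : Fact (Nat.Prime 2) := ⟨Nat.prime_two⟩
    have : Fact (Nat.Prime 3) := ⟨Nat.prime_three⟩
    simp only [signTwoThree, PNat.mul_coe, padicValNat.mul m.ne_zero n.ne_zero]
    ring

theorem signTwoThree_two : signTwoThree 2 = -1 := by
  have h : padicValNat 3 2 = 0 := padicValNat.eq_zero_of_not_dvd (by decide)
  simp [signTwoThree, h]

theorem signTwoThree_three : signTwoThree 3 = -1 := by
  have h : padicValNat 2 3 = 0 := padicValNat.eq_zero_of_not_dvd (by decide)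
  simp [signTwoThree, h]

theorem signTwoThree_prime {p : ℕ+} (hp : p.Prime) (h : signTwoThree p ≠ 1) : p = 2 ∨ p = 3 := by
  by_contra! hne
  have h2 : ¬ 2 ∣ (p : ℕ) := fun hd =>
    hne.1 (PNat.eq ((Nat.prime_dvd_prime_iff_eq Nat.prime_two hp).mp hd).symm)
  have h3 : ¬ 3 ∣ (p : ℕ) := fun hd =>
    hne.2 (PNat.eq ((Nat.prime_dvd_prime_iff_eq Nat.prime_three hp).mp hd).symm)
  exact h (by simp [signTwoThree, padicValNat.eq_zero_of_not_dvd h2,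
    padicValNat.eq_zero_of_not_dvd h3])

theorem not_isAutomatic_signTwoThree {k : ℕ+} (hk : 2 ≤ k) : ¬ IsAutomatic k signTwoThree := by
  refine not_isAutomatic_of_two_primes signTwoThreeHom ?_ ⟨2, 3, Nat.prime_two, Nat.prime_three,
    by decide, ?_⟩ hk
  · exact (Set.toFinite {2, 3}).subset fun p hp => signTwoThree_prime hp.1 hp.2
  · change signTwoThree 2 ≠ 1 ∧ signTwoThree 2 ≠ 0 ∧ signTwoThree 3 ≠ 1 ∧ signTwoThree 3 ≠ 0
    rw [signTwoThree_two, signTwoThree_three]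
    norm_num

theorem corollary1 :
    (∀ (K : Type*) [Field K] (u : ℕ+ →* K),
      {p : ℕ+ | p.Prime ∧ u p ≠ 1}.Finite →
      (∃ p₁ p₂ : ℕ+, p₁.Prime ∧ p₂.Prime ∧ p₁ ≠ p₂ ∧
        u p₁ ≠ 1 ∧ u p₁ ≠ 0 ∧ u p₂ ≠ 1 ∧ u p₂ ≠ 0) →
      ∀ k : ℕ+, 2 ≤ k →
        ¬ IsAutomatic k (fun n => u n) ∧
        ∀ v : ℕ → K, (∀ n : ℕ+, v n = u n) → ¬ IsAutomaticFromZero k v) ∧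
    (∀ k : ℕ+, 2 ≤ k →
      ¬ IsAutomatic k signTwoThree ∧
      ∀ v : ℕ → ℝ, (∀ n : ℕ+, v n = signTwoThree n) → ¬ IsAutomaticFromZero k v) := by
  refine ⟨fun K _ u hfin h k hk => ?_, fun k hk => ?_⟩
  · have hu := not_isAutomatic_of_two_primes u hfin h hk
    exact ⟨hu, fun v hv hvk => hu (funext hv ▸ hvk.restrict)⟩
  · have hu := not_isAutomatic_signTwoThree hk
    exact ⟨hu, fun v hv hvk => hu (funext hv ▸ hvk.restrict)⟩
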